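/- Let $p\colon A\to B$ be a surjective morphism of (not necessarily commutative) rings. Modules are right modules, $\mathrm{D}(A)$ and $\mathrm{D}(B)$ are the unbounded derived categories of all modules, and for a $B$-$A$-bimodule $L$ the functor $\mathbf{R}\mathrm{Hom}_A(L,-)\colon \mathrm{D}(A)\to \mathrm{D}(B)$ is the total right derived functor of $\mathrm{Hom}_A(L,-)$. Let $F=-\otimes^{\mathbf L}_B B_A\colon \mathrm{D}(B)\to \mathrm{D}(A)$ be the restriction of scalars along $p$. Then $\mathbf{R}\mathrm{Hom}_A({}_BB_A,-)$ exists and is a right adjoint of $F$, and the functor $$\mathcal T=\mathbf{R}\mathrm{Hom}_A({}_A\ker p_A,-)\colon \mathrm{D}(A)\to \mathrm{D}(A)$$ exists and is the twist around $F$. That is: $F$ has a left adjoint and a right adjoint, and for every right adjoint $F^{\mathrm{RA}}$ of $F$, with counit $\varepsilon\colon FF^{\mathrm{RA}}\to 1_{\mathrm{D}(A)}$, there are natural transformations $u\colon 1_{\mathrm{D}(A)}\to\mathcal T$ and $w\colon \mathcal T\to FF^{\mathrm{RA}}[1]$ such that for every $a\in \mathrm{D}(A)$ the triangle $$FF^{\mathrm{RA}}(a)\xrightarrow{\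 \varepsilon_a\ } a\xrightarrow{\ u_a\ }\mathcal T(a)\xrightarrow{\ w_a\ }FF^{\mathrm{RA}}(a)[1]$$ is distinguished. -/

import Mathlib

open CategoryTheory

universe w₁ w₂ u

namespace TwistRing

/-! Right modules over a ring `A` are left modules over `Aᵐᵒᵖ`, and `D(A)` is the unbounded derived
category `DerivedCategory (ModuleCat Aᵐᵒᵖ)`.  A `B`-`A`-bimodule is an abelian group `L` with
commuting actions of `B` (on the left) and of `Aᵐᵒᵖ` (that is, of `A` on the right). -/

section BimoduleHom

variable (A B : Type u) [Ring A] [Ring B] (L : Type u) [AddCommGroup L]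
  [Module B L] [Module Aᵐᵒᵖ L] [SMulCommClass B Aᵐᵒᵖ L]

/-- The abelian group `Hom_A(L, M)` of right `A`-linear maps. The ring `B` acting on `L` on the left
is recorded, since it determines the right `B`-module structure defined below. -/
@[nolint unusedArguments]
def BimoduleHom (A B : Type u) [Ring A] [Ring B] (L : Type u) [AddCommGroup L]
    [Module B L] [Module Aᵐᵒᵖ L] [SMulCommClass B Aᵐᵒᵖ L]
    (M : Type u) [AddCommGroup M] [Module Aᵐᵒᵖ M] : Type u :=
  L →ₗ[Aᵐᵒᵖ] M

namespace BimoduleHom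

variable (M : Type u) [AddCommGroup M] [Module Aᵐᵒᵖ M]

instance : AddCommGroup (BimoduleHom A B L M) :=
  inferInstanceAs (AddCommGroup (L →ₗ[Aᵐᵒᵖ] M))

/-- The right `B`-module structure on `Hom_A(L, M)`: `(f · b)(x) = f (b x)`. -/
instance : Module Bᵐᵒᵖ (BimoduleHom A B L M) where
  smul b f := LinearMap.comp (show L →ₗ[Aᵐᵒᵖ] M from f) (Module.toModuleEnd Aᵐᵒᵖ L b.unop)
  one_smul f := LinearMap.ext fun x => congrArg (show L →ₗ[Aᵐᵒᵖ] M from f) (one_smul B x)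
  mul_smul b c f := LinearMap.ext fun x =>
    congrArg (show L →ₗ[Aᵐᵒᵖ] M from f) (mul_smul c.unop b.unop x)
  smul_zero _ := rfl
  smul_add _ _ _ := rfl
  add_smul b c f := LinearMap.ext fun x =>
    (congrArg (show L →ₗ[Aᵐᵒᵖ] M from f) (add_smul b.unop c.unop x)).trans
      (map_add (show L →ₗ[Aᵐᵒᵖ] M from f) _ _)
  zero_smul f := LinearMap.ext fun x =>
    (congrArg (show L →ₗ[Aᵐᵒᵖ] M from f) (zero_smul B x)).trans
      (map_zero (show L →ₗ[Aᵐᵒᵖ] M from f))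

end BimoduleHom

/-- The functor `Hom_A(L, -)` from right `A`-modules to right `B`-modules. -/
def bimoduleHom : ModuleCat.{u} Aᵐᵒᵖ ⥤ ModuleCat.{u} Bᵐᵒᵖ where
  obj M := ModuleCat.of Bᵐᵒᵖ (BimoduleHom A B L M)
  map {M N} g := ModuleCat.ofHom
    { toFun := fun f => LinearMap.comp g.hom (show L →ₗ[Aᵐᵒᵖ] M from f)
      map_add' := fun _ _ => LinearMap.ext fun _ => map_add g.hom _ _
      map_smul' := fun _ _ => rfl }

instance : (bimoduleHom A B L).Additive where

/-- The functor `K(A) ⥤ D(B)` induced by `Hom_A(L, -)`. -/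
noncomputable def bimoduleHomK [HasDerivedCategory.{w₂} (ModuleCat.{u} Bᵐᵒᵖ)] :
    HomotopyCategory (ModuleCat.{u} Aᵐᵒᵖ) (ComplexShape.up ℤ) ⥤
      DerivedCategory (ModuleCat.{u} Bᵐᵒᵖ) :=
  (bimoduleHom A B L).mapHomotopyCategory (ComplexShape.up ℤ) ⋙ DerivedCategory.Qh

/-- `Hom_A(L, -)` has a total right derived functor on unbounded complexes. -/
abbrev HasRHom [HasDerivedCategory.{w₂} (ModuleCat.{u} Bᵐᵒᵖ)] : Prop :=
  (bimoduleHomK.{w₂} A B L).HasRightDerivedFunctor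
    (HomotopyCategory.quasiIso (ModuleCat.{u} Aᵐᵒᵖ) (ComplexShape.up ℤ))

/-- `RHom_A(L, -) : D(A) ⥤ D(B)`, the total right derived functor of `Hom_A(L, -)`. -/
noncomputable def RHom [HasDerivedCategory.{w₁} (ModuleCat.{u} Aᵐᵒᵖ)]
    [HasDerivedCategory.{w₂} (ModuleCat.{u} Bᵐᵒᵖ)] [HasRHom.{w₂} A B L] :
    DerivedCategory (ModuleCat.{u} Aᵐᵒᵖ) ⥤ DerivedCategory (ModuleCat.{u} Bᵐᵒᵖ) :=
  (bimoduleHomK.{w₂} A B L).totalRightDerived DerivedCategory.Qh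
    (HomotopyCategory.quasiIso (ModuleCat.{u} Aᵐᵒᵖ) (ComplexShape.up ℤ))

end BimoduleHom

section RingMorphism

variable {A B : Type u} [Ring A] [Ring B] (p : A →+* B)

/-- The ring `B`, seen as a `B`-`A`-bimodule through `p : A →+* B`. -/
@[nolint unusedArguments]
def Target {A B : Type u} [Ring A] [Ring B] (_p : A →+* B) : Type u := B

instance : AddCommGroup (Target p) := inferInstanceAs (AddCommGroup B)

/-- The left `B`-action: `b • x = b * x`. -/
instance : Module B (Target p) := inferInstanceAs (Module B B)

/-- The right `A`-action: `x · a = x * p a`. -/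
instance : Module Aᵐᵒᵖ (Target p) := Module.compHom B (RingHom.op p)

instance : SMulCommClass B Aᵐᵒᵖ (Target p) where
  smul_comm b a x := (mul_assoc b (show B from x) (p a.unop)).symm

instance : Limits.PreservesFiniteLimits (ModuleCat.restrictScalars.{u} (RingHom.op p)) where
  preservesFiniteLimits _ _ _ := ⟨inferInstance⟩

instance : Limits.PreservesFiniteColimits (ModuleCat.restrictScalars.{u} (RingHom.op p)) where
  preservesFiniteColimits _ _ _ := ⟨inferInstance⟩

/-- The restriction of scalars `D(B) ⥤ D(A)` along `p` (an exact functor on modules). -/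
noncomputable def restriction [HasDerivedCategory.{w₁} (ModuleCat.{u} Aᵐᵒᵖ)]
    [HasDerivedCategory.{w₂} (ModuleCat.{u} Bᵐᵒᵖ)] :
    DerivedCategory (ModuleCat.{u} Bᵐᵒᵖ) ⥤ DerivedCategory (ModuleCat.{u} Aᵐᵒᵖ) :=
  (ModuleCat.restrictScalars.{u} (RingHom.op p)).mapDerivedCategory

end RingMorphism

/-- `T` is the twist around `S`: the functor `S` has a left and a right adjoint, and, for the right
adjoint `R`, there is a functorial triangle `R ⋙ S ⟶ 𝟭 ⟶ T ⟶ (R ⋙ S)⟦1⟧` whose first map is the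
counit of the adjunction. -/
structure IsTwistAround {C D : Type*} [Category* C] [Category* D] [Preadditive D]
    [Limits.HasZeroObject D] [HasShift D ℤ] [∀ n : ℤ, (shiftFunctor D n).Additive]
    [Pretriangulated D] (S : C ⥤ D) (T : D ⥤ D) : Prop where
  hasLeftAdjoint : S.IsRightAdjoint
  hasRightAdjoint : S.IsLeftAdjoint
  triangle : ∀ (R : D ⥤ C) (adj : S ⊣ R),
    ∃ (u : 𝟭 D ⟶ T) (w : T ⟶ (R ⋙ S) ⋙ shiftFunctor D (1 : ℤ)), ∀ a : D,
      Pretriangulated.Triangle.mk (adj.counit.app a) (u.app a) (w.app a) ∈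
        Pretriangulated.distinguishedTriangles

end TwistRing

/-! Apply `Hom_A(-, M)` to the bimodule sequence `0 → ker p → A → B → 0`. For injective `M` this
gives a short exact sequence `0 → Hom_A(B, M) → M → Hom_A(ker p, M) → 0`, whose first map,
evaluation at `1`, is the counit of the adjunction between restriction and `Hom_A(B, -)`
(`shortExact_evalOne_smulIdeal`). On a K-injective complex with injective terms both derived
functors are computed termwise, so the triangle of this sequence of complexes is the required one
(`exists_twist_triangle`).

Three points need work. Unbounded complexes must have such resolutions:
`exists_quasiIso_isKInjective` builds them from injective resolutions of the canonical truncations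
and a telescope; the dual gives K-projective resolutions. The adjunction must descend to derived
categories with a known counit (`mapDerivedCategory_counit_app`); uniqueness of adjoints then covers
an arbitrary right adjoint. Finally `u` and `w` must be natural on `D(A)`: they are natural on
cochain complexes, and the termwise injective K-injective complexes map to `D(A)` by a full,
essentially surjective functor, which suffices (`exists_natTrans_of_full_of_essSurj`).

The left adjoint of restriction exists because the left adjoint on modules preserves K-projectivity.
-/

open Limits

/-! ### Eventually surjective towers of abelian groups -/

namespace TowerLimit

/-- In an inverse system of abelian groups whose transition maps are eventually surjective,
every family of discrepancies is realised. -/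
lemma exists_sub_eq {H : ℕ → Type*} [∀ n, AddCommGroup (H n)] (N : ℕ)
    (t : ∀ n, H (n + 1) →+ H n) (ht : ∀ n, N ≤ n → Function.Surjective (t n)) (y : ∀ n, H n) :
    ∃ s : ∀ n, H n, ∀ n, s n - t n (s (n + 1)) = y n := by
  induction N generalizing H with
  | zero =>
    choose g hg using fun n => ht n (Nat.zero_le n)
    -- Start from `0` and solve `t n (s (n + 1)) = s n - y n` upwards, using sections of the `t n`.
    refine ⟨fun n => Nat.rec (motive := H) 0 (fun n x => g n (x - y n)) n, fun n => ?_⟩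
    simp [hg]
  | succ N ih =>
    obtain ⟨s, hs⟩ := ih (H := fun n => H (n + 1)) (fun n => t (n + 1))
      (fun n hn => ht (n + 1) (by lia)) (fun n => y (n + 1))
    -- Once the shifted tower is solved, the bottom term is forced; `t 0` need not be surjective.
    refine ⟨fun n => Nat.casesOn n (y 0 + t 0 (s 0)) s, fun n => ?_⟩
    cases n with
    | zero => simp
    | succ n => exact hs n

end TowerLimit

/-! ### Canonical truncations -/

namespace CochainComplex

variable {C : Type*} [Category* C] [Abelian C]

/-- Truncation alters a complex only below `n` and in the boundary degree `n` itself, hence the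
strict inequality. -/
lemma isIso_πTruncGE_f (K : CochainComplex C ℤ) (n i : ℤ) (hi : n < i) :
    IsIso ((K.πTruncGE n).f i) := by
  obtain ⟨j, rfl⟩ : ∃ j : ℕ, i = n + j := ⟨(i - n).toNat, by lia⟩
  have hb : ¬ (ComplexShape.embeddingUpIntGE n).BoundaryGE j := by
    rw [ComplexShape.boundaryGE_embeddingUpIntGE_iff]
    lia
  have := K.isIso_restrictionToTruncGE' (ComplexShape.embeddingUpIntGE n) j hb
  exact (ComplexShape.Embedding.isIso_liftExtend_f_iff _ _
    (K.restrictionToTruncGE'_hasLift _) (by simp)).2 this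

/-- The transition map between two consecutive canonical truncations. -/
noncomputable def truncGETransition (K : CochainComplex C ℤ) (m n : ℤ) (h : m ≤ n) :
    K.truncGE m ⟶ K.truncGE n :=
  haveI := isStrictlyGE_of_ge (K.truncGE n) m n h
  truncGEMap (K.πTruncGE n) m ≫ inv ((K.truncGE n).πTruncGE m)

lemma πTruncGE_comp_truncGETransition (K : CochainComplex C ℤ) (m n : ℤ) (h : m ≤ n) :
    K.πTruncGE m ≫ K.truncGETransition m n h = K.πTruncGE n := by
  have := isStrictlyGE_of_ge (K.truncGE n) m n h
  rw [truncGETransition, πTruncGE_naturality_assoc, IsIso.hom_inv_id, Category.comp_id]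

/-! ### Countable products of complexes -/

section Product

variable [HasLimitsOfShape (Discrete ℕ) C]

/-- A sequence of complexes, as a complex of families of objects. -/
@[simps]
def familyComplex (X : ℕ → CochainComplex C ℤ) :
    HomologicalComplex (Discrete ℕ ⥤ C) (ComplexShape.up ℤ) where
  X k := Discrete.functor fun n => (X n).X k
  d i j := Discrete.natTrans fun n => (X n.as).d i j
  shape i j h := by
    ext n
    exact (X n.as).shape i j h

/-- A sequence of morphisms of complexes, as a morphism of complexes of families. -/
@[simps]
def familyMap {X Y : ℕ → CochainComplex C ℤ} (φ : ∀ n, X n ⟶ Y n) :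
    familyComplex X ⟶ familyComplex Y where
  f k := Discrete.natTrans fun n => (φ n.as).f k
  comm' i j _ := by
    ext n
    exact (φ n.as).comm i j

/-- The degreewise product of a sequence of complexes. -/
noncomputable def piComplex (X : ℕ → CochainComplex C ℤ) : CochainComplex C ℤ :=
  (lim.mapHomologicalComplex _).obj (familyComplex X)

/-- The product of a sequence of morphisms of complexes. -/
noncomputable def piMap {X Y : ℕ → CochainComplex C ℤ} (φ : ∀ n, X n ⟶ Y n) :
    piComplex X ⟶ piComplex Y :=
  (lim.mapHomologicalComplex _).map (familyMap φ)

variable (X : ℕ → CochainComplex C ℤ)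

/-- The projections of the product complex in a given degree. -/
noncomputable def piProjX (n : ℕ) (k : ℤ) : (piComplex X).X k ⟶ (X n).X k :=
  limit.π (Discrete.functor fun n => (X n).X k) ⟨n⟩

variable {X} in
/-- The morphism to the product complex in a given degree. -/
noncomputable def piLiftX {A : C} {k : ℤ} (φ : ∀ n, A ⟶ (X n).X k) : A ⟶ (piComplex X).X k :=
  limit.lift (Discrete.functor fun n => (X n).X k) (Fan.mk A φ)

@[simp]
lemma piLiftX_piProjX {A : C} {k : ℤ} (φ : ∀ n, A ⟶ (X n).X k) (n : ℕ) :
    piLiftX φ ≫ piProjX X n k = φ n :=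
  limit.lift_π _ _

@[simp]
lemma piLiftX_piProjX_assoc {A Z : C} {k : ℤ} (φ : ∀ n, A ⟶ (X n).X k) (n : ℕ)
    (h : (X n).X k ⟶ Z) : piLiftX φ ≫ piProjX X n k ≫ h = φ n ≫ h := by
  rw [← Category.assoc, piLiftX_piProjX]

variable {X} in
lemma piX_hom_ext {A : C} {k : ℤ} {f g : A ⟶ (piComplex X).X k}
    (h : ∀ n, f ≫ piProjX X n k = g ≫ piProjX X n k) : f = g :=
  limit.hom_ext fun ⟨n⟩ => h n

lemma piComplex_d_piProjX (n : ℕ) (i j : ℤ) :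
    (piComplex X).d i j ≫ piProjX X n j = piProjX X n i ≫ (X n).d i j :=
  limMap_π _ _

/-- The projections of the product complex. -/
@[simps]
noncomputable def piProj (n : ℕ) : piComplex X ⟶ X n where
  f k := piProjX X n k
  comm' i j _ := (piComplex_d_piProjX X n i j).symm

variable {X} in
/-- The morphism to the product complex given by a family of morphisms. -/
@[simps]
noncomputable def piLift {K : CochainComplex C ℤ} (φ : ∀ n, K ⟶ X n) : K ⟶ piComplex X where
  f k := piLiftX fun n => (φ n).f k
  comm' i j _ := piX_hom_ext fun n => by simp [piComplex_d_piProjX]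

instance injective_piComplex_X (k : ℤ) [∀ n, Injective ((X n).X k)] :
    Injective ((piComplex X).X k) where
  factors g f _ := ⟨piLiftX fun n => Injective.factorThru (g ≫ piProjX X n k) f,
    piX_hom_ext fun n => by simp⟩

instance isKInjective_piComplex [∀ n, (X n).IsKInjective] : (piComplex X).IsKInjective where
  nonempty_homotopy_zero {K} f hK := by
    let h n := IsKInjective.homotopyZero (f ≫ piProj X n) hK
    refine ⟨{ hom := fun i j => piLiftX fun n => (h n).hom i j, zero := fun i j hij => ?_,
              comm := fun i => ?_ }⟩
    · exact piX_hom_ext fun n => by simp [(h n).zero i j hij]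
    · refine piX_hom_ext fun n => ?_
      have := (h n).comm i
      rw [dNext_eq _ (show (ComplexShape.up ℤ).Rel i (i + 1) from rfl),
        prevD_eq _ (show (ComplexShape.up ℤ).Rel (i - 1) i by simp)] at this ⊢
      simpa [piComplex_d_piProjX] using this

/-- The product functor preserves kernels, so preserving epimorphisms makes it exact;
quasi-isomorphisms of families are detected componentwise. -/
lemma quasiIso_piMap [(lim : (Discrete ℕ ⥤ C) ⥤ C).PreservesEpimorphisms]
    {X Y : ℕ → CochainComplex C ℤ} (φ : ∀ n, X n ⟶ Y n) [∀ n, QuasiIso (φ n)] :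
    QuasiIso (piMap φ) := by
  have : QuasiIso (familyMap φ) := by
    rw [HomologicalComplex.quasiIso_iff_evaluation]
    rintro ⟨n⟩
    exact inferInstanceAs (QuasiIso (φ n))
  have : (lim : (Discrete ℕ ⥤ C) ⥤ C).PreservesHomology :=
    Functor.preservesHomology_of_preservesEpis_and_kernels _
  have : (lim : (Discrete ℕ ⥤ C) ⥤ C).Additive := Functor.additive_of_preserves_binary_products _
  exact inferInstanceAs (QuasiIso ((lim.mapHomologicalComplex _).map (familyMap φ)))

/-! ### The telescope of an eventually constant tower -/

section Telescope

variable {X} {K : CochainComplex C ℤ} (p : ∀ n, K ⟶ X n) (τ : ∀ n, X (n + 1) ⟶ X n)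
  (hp : ∀ n, p (n + 1) ≫ τ n = p n)

/-- The difference of the identity and the shift on the product of a tower of complexes. -/
noncomputable def telescopeMap : piComplex X ⟶ piComplex X :=
  piLift fun n => piProj X n - piProj X (n + 1) ≫ τ n

include hp in
lemma piLift_telescopeMap : piLift p ≫ telescopeMap τ = 0 := by
  ext k
  exact piX_hom_ext fun n => by simp [telescopeMap, ← hp n]

/-- The telescope sequence of a tower of complexes under a given complex. -/
@[simps]
noncomputable def telescope : ShortComplex (CochainComplex C ℤ) :=
  ShortComplex.mk (piLift p) (telescopeMap τ) (piLift_telescopeMap p τ hp)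

-- A family killed by the telescope map is compatible with the transitions, so its component at `N`
-- determines it: upwards because the `τ n` are invertible there, downwards by applying them.
include hp in
lemma exists_comp_piLift_eq {k : ℤ} (N : ℕ) (hN : ∀ n, N ≤ n → IsIso ((p n).f k))
    {A : C} (z : A ⟶ (piComplex X).X k) (hz : z ≫ (telescopeMap τ).f k = 0) :
    ∃ l : A ⟶ K.X k, l ≫ (piLift p).f k = z := by
  have hpk (n : ℕ) : (p (n + 1)).f k ≫ (τ n).f k = (p n).f k := by
    rw [← HomologicalComplex.comp_f, hp]
  have := hN N le_rfl
  have hz' (n : ℕ) : z ≫ piProjX X n k = (z ≫ piProjX X (n + 1) k) ≫ (τ n).f k := by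
    have := hz =≫ piProjX X n k
    simpa [telescopeMap, sub_eq_zero] using this
  refine ⟨z ≫ piProjX X N k ≫ inv ((p N).f k), piX_hom_ext fun n => ?_⟩
  suffices h : (z ≫ piProjX X N k ≫ inv ((p N).f k)) ≫ (p n).f k = z ≫ piProjX X n k by
    simpa using h
  obtain hn | hn := le_total N n
  · induction n, hn using Nat.le_induction with
    | base => simp
    | succ n hn ih =>
      have := hN n hn
      have := hN (n + 1) (by lia)
      have := IsIso.of_isIso_fac_left (hpk n)
      rw [← cancel_mono ((τ n).f k), Category.assoc _ ((p (n + 1)).f k), hpk, ih, hz']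
  · induction hn using Nat.decreasingInduction with
    | self => simp
    | of_succ n hn ih => rw [hz', ← ih, Category.assoc _ ((p (n + 1)).f k), hpk]

lemma shortExact_telescope (hK : ∀ k : ℤ, ∃ N, ∀ n, N ≤ n → IsIso ((p n).f k)) :
    (telescope p τ hp).ShortExact := by
  refine HomologicalComplex.shortExact_of_degreewise_shortExact _ fun k => ?_
  obtain ⟨N, hN⟩ := hK k
  have hpk (n : ℕ) : (p (n + 1)).f k ≫ (τ n).f k = (p n).f k := by
    rw [← HomologicalComplex.comp_f, hp]
  have hτ (n : ℕ) (hn : N ≤ n) : IsIso ((τ n).f k) := by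
    have := hN n hn
    have := hN (n + 1) (by lia)
    exact IsIso.of_isIso_fac_left (hpk n)
  have hpN := hN N le_rfl
  have hmono : Mono ((piLift p).f k) := by
    have h : (piLift p).f k ≫ piProjX X N k = (p N).f k :=
      piLiftX_piProjX X (fun n => (p n).f k) N
    have : Mono ((piLift p).f k ≫ piProjX X N k) := by rw [h]; infer_instance
    exact mono_of_mono _ (piProjX X N k)
  have hepi : Epi ((telescopeMap τ).f k) := by
    let P := (piComplex X).X k
    -- Taking the projections as discrepancies in the tower `Hom(P, X n)` yields a section of the
    -- telescope map in degree `k`.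
    obtain ⟨s, hs⟩ := TowerLimit.exists_sub_eq (H := fun n => (P ⟶ (X n).X k)) N
      (fun n => (Preadditive.rightComp P ((τ n).f k)))
      (fun n hn z => by
        have := hτ n hn
        exact ⟨z ≫ inv ((τ n).f k), (Category.assoc _ _ _).trans
          (by rw [IsIso.inv_hom_id, Category.comp_id])⟩) (fun n => piProjX X n k)
    have : piLiftX s ≫ (telescopeMap τ).f k = 𝟙 P := piX_hom_ext fun n => by
      refine Eq.trans ?_ ((hs n).trans (Category.id_comp _).symm)
      simp [telescopeMap, Preadditive.rightComp]
    exact epi_of_epi_fac this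
  refine ShortComplex.ShortExact.mk' ?_ hmono hepi
  have : Mono ((telescope p τ hp).map (HomologicalComplex.eval C _ k)).f := hmono
  exact ShortComplex.exact_of_f_is_kernel _ (KernelFork.IsLimit.ofι' _ _ fun z hz =>
    Classical.indefiniteDescription _ (exists_comp_piLift_eq p τ hp N hN z hz))

end Telescope

end Product
end CochainComplex

/-! ### K-injective and K-projective resolutions -/

open Pretriangulated

namespace CochainComplex

variable {C : Type*} [Category* C] [Abelian C]

lemma injective_mappingCone_X {K L : CochainComplex C ℤ} (φ : K ⟶ L) (n : ℤ)
    [∀ n, Injective (K.X n)] [∀ n, Injective (L.X n)] : Injective ((mappingCone φ).X n) :=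
  Injective.of_iso (HomologicalComplex.homotopyCofiber.XIsoBiprod φ n (n + 1) rfl).symm
    inferInstance

lemma isKInjective_mappingCone {K L : CochainComplex C ℤ} (φ : K ⟶ L)
    [K.IsKInjective] [L.IsKInjective] : (mappingCone φ).IsKInjective := by
  rw [isKInjective_iff_rightOrthogonal]
  exact ObjectProperty.ext_of_isTriangulatedClosed₃ _ _
    (HomotopyCategory.mappingCone_triangleh_distinguished φ)
    (IsKInjective.rightOrthogonal K) (IsKInjective.rightOrthogonal L)

/-- Morphisms into a K-injective complex agree in the homotopy and derived categories, and homotopy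
classes have representatives. -/
lemma IsKInjective.Q_map_surjective [HasDerivedCategory C] (K L : CochainComplex C ℤ)
    [L.IsKInjective] :
    Function.Surjective (DerivedCategory.Q.map : (K ⟶ L) → _) := by
  intro f
  obtain ⟨g, hg⟩ := (IsKInjective.Qh_map_bijective _ L).surjective
    ((DerivedCategory.quotientCompQhIso C).hom.app K ≫ f ≫
      (DerivedCategory.quotientCompQhIso C).inv.app L)
  obtain ⟨g, rfl⟩ := (HomotopyCategory.quotient _ _).map_surjective g
  refine ⟨g, ?_⟩
  have := (DerivedCategory.quotientCompQhIso C).hom.naturality g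
  rw [← cancel_epi ((DerivedCategory.quotientCompQhIso C).hom.app K), ← this]
  dsimp at hg ⊢
  simp [hg]

/-- In an abelian category with enough injectives and exact countable products, every complex
is quasi-isomorphic to a K-injective complex of injective objects. -/
lemma exists_quasiIso_isKInjective [EnoughInjectives C] [HasLimitsOfShape (Discrete ℕ) C]
    [(lim : (Discrete ℕ ⥤ C) ⥤ C).PreservesEpimorphisms] (K : CochainComplex C ℤ) :
    ∃ (L : CochainComplex C ℤ) (i : K ⟶ L),
      QuasiIso i ∧ L.IsKInjective ∧ ∀ n, Injective (L.X n) := by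
  let := HasDerivedCategory.standard C
  -- The rotated telescope triangle presents `K⟦1⟧`, rather than `K`, as a cone.
  suffices h : ∀ K : CochainComplex C ℤ, ∃ (L : CochainComplex C ℤ) (i : K⟦(1 : ℤ)⟧ ⟶ L),
      QuasiIso i ∧ L.IsKInjective ∧ ∀ n, Injective (L.X n) by
    obtain ⟨L, i, hi, hL⟩ := h (K⟦(-1 : ℤ)⟧)
    exact ⟨L, (shiftNegShift K (1 : ℤ)).inv ≫ i, inferInstance, hL⟩
  clear K
  intro K
  have hI (n : ℕ) : ∃ (L : CochainComplex C ℤ) (i : K.truncGE (-n : ℤ) ⟶ L),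
      QuasiIso i ∧ (∀ n, Injective (L.X n)) ∧ L.IsKInjective := by
    obtain ⟨L, i, hi, hL, _⟩ :=
      Plus.modelCategoryQuillen.exists_quasiIso_injective (K.truncGE (-n : ℤ)) (-n)
    exact ⟨L, i, hi, hL, isKInjective_of_injective L (-n)⟩
  choose I i hi hI hI' using hI
  have hp (n : ℕ) : K.πTruncGE (-(n + 1 : ℕ) : ℤ) ≫ K.truncGETransition _ _ (by lia) =
      K.πTruncGE (-n : ℤ) := πTruncGE_comp_truncGETransition _ _ _ _
  have hS := shortExact_telescope (X := fun n : ℕ => K.truncGE (-n : ℤ))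
    (fun n : ℕ => K.πTruncGE (-n : ℤ)) _ hp
    -- The bound ensures `-n < k`, so degree `k` lies strictly above the truncation.
    (fun k => ⟨(1 - k).toNat, fun n hn => isIso_πTruncGE_f K _ _ (by lia)⟩)
  have := quasiIso_piMap i
  let t := telescopeMap (X := fun n : ℕ => K.truncGE (-n : ℤ))
    (fun n : ℕ => K.truncGETransition (-(n + 1 : ℕ)) (-n) (by lia))
  -- The telescope map transports to the product of resolutions only in the derived category;
  -- K-injectivity makes it a genuine chain map, whose cone is the resolution.
  obtain ⟨ψ, hψ⟩ := IsKInjective.Q_map_surjective (piComplex I) (piComplex I)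
    (inv (DerivedCategory.Q.map (piMap i)) ≫ DerivedCategory.Q.map t ≫
      DerivedCategory.Q.map (piMap i))
  have hcomm : DerivedCategory.Q.map t ≫ DerivedCategory.Q.map (piMap i) =
      DerivedCategory.Q.map (piMap i) ≫ DerivedCategory.Q.map ψ := by
    rw [hψ, IsIso.hom_inv_id_assoc]
  have hQ : IsIso (DerivedCategory.Q.map (piMap i)) := inferInstance
  have h₁ := rot_of_distTriang _ (DerivedCategory.triangleOfSES_distinguished hS)
  have h₂ : DerivedCategory.Q.mapTriangle.obj (mappingCone.triangle ψ) ∈ distTriang _ := by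
    rw [DerivedCategory.mem_distTriang_iff]
    exact ⟨_, _, ψ, ⟨Iso.refl _⟩⟩
  have := isKInjective_mappingCone ψ
  obtain ⟨c, hc₁, hc₂⟩ := complete_distinguished_triangle_morphism _ _ h₁ h₂
    (DerivedCategory.Q.map (piMap i)) (DerivedCategory.Q.map (piMap i)) hcomm
  have hc : IsIso c := isIso₃_of_isIso₁₂
    { hom₁ := DerivedCategory.Q.map (piMap i)
      hom₂ := DerivedCategory.Q.map (piMap i)
      hom₃ := c
      comm₁ := hcomm
      comm₂ := hc₁
      comm₃ := hc₂ } h₁ h₂ hQ hQ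
  let c' : (DerivedCategory.Q.obj K)⟦(1 : ℤ)⟧ ⟶ DerivedCategory.Q.obj (mappingCone ψ) := c
  have : IsIso c' := hc
  obtain ⟨j, hj⟩ := IsKInjective.Q_map_surjective (K⟦(1 : ℤ)⟧) (mappingCone ψ)
    ((DerivedCategory.Q.commShiftIso (1 : ℤ)).hom.app K ≫ c')
  refine ⟨mappingCone ψ, j, ?_, inferInstance, fun n => injective_mappingCone_X ψ n⟩
  rw [← DerivedCategory.isIso_Q_map_iff_quasiIso, hj]
  infer_instance

-- Products in `Cᵒᵖ` are coproducts in `C`, and epimorphisms become monomorphisms, which exact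
-- coproducts preserve.
open Opposite in
lemma preservesEpimorphisms_lim_op [HasColimitsOfShape (Discrete ℕ) C]
    [HasExactColimitsOfShape (Discrete ℕ) C] :
    (lim : (Discrete ℕ ⥤ Cᵒᵖ) ⥤ Cᵒᵖ).PreservesEpimorphisms where
  preserves {F G} f hf := by
    have : HasColimitsOfShape (Discrete ℕ)ᵒᵖ C :=
      hasColimitsOfShape_of_equivalence (Discrete.opposite ℕ).symm
    have : HasExactColimitsOfShape (Discrete ℕ)ᵒᵖ C :=
      HasExactColimitsOfShape.of_domain_equivalence C (Discrete.opposite ℕ).symm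
    have : Mono (NatTrans.leftOp f) := by
      have (j : (Discrete ℕ)ᵒᵖ) : Mono ((NatTrans.leftOp f).app j) :=
        inferInstanceAs (Mono (f.app j.unop).unop)
      exact NatTrans.mono_of_mono_app _
    have hm : Mono (colim.map (NatTrans.leftOp f)) := inferInstance
    let hF := isLimitConeOfCoconeLeftOp F (colimit.isColimit F.leftOp)
    let hG := isLimitConeOfCoconeLeftOp G (colimit.isColimit G.leftOp)
    have h : lim.map f = (hF.conePointUniqueUpToIso (limit.isLimit F)).inv ≫
        (colim.map (NatTrans.leftOp f)).op ≫
          (hG.conePointUniqueUpToIso (limit.isLimit G)).hom := by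
      refine limit.hom_ext fun j => ?_
      have h₁ := hG.conePointUniqueUpToIso_hom_comp (limit.isLimit G) j
      have h₂ := hF.conePointUniqueUpToIso_inv_comp (limit.isLimit F) j
      have h₃ := congrArg Quiver.Hom.op (ι_colimMap (NatTrans.leftOp f) (op j))
      dsimp at h₁ h₂ h₃ ⊢
      rw [Category.assoc, Category.assoc, h₁, limMap_π, ← h₂, Category.assoc]
      congr 1
      exact h₃.symm
    rw [h]
    infer_instance

open Opposite in
lemma quasiIso_of_opEquivalence {K L : CochainComplex C ℤ} (f : K ⟶ L)
    (hf : QuasiIso ((opEquivalence C).functor.map f.op)) : QuasiIso f where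
  quasiIsoAt n := by
    obtain ⟨m, rfl⟩ : ∃ m : ℤ, n = -m := ⟨-n, by simp⟩
    have := hf.quasiIsoAt m
    rw [quasiIsoAt_iff' _ (m - 1) m (m + 1) (by simp) (by simp)] at this
    rw [quasiIsoAt_iff' _ (-(m + 1)) (-m) (-(m - 1)) (by grind [prev]) (by grind [next])]
    exact (ShortComplex.quasiIso_opMap_iff _).1 this

open Opposite in
/-- In an abelian category with enough projectives and exact countable coproducts, every complex
is quasi-isomorphic to a K-projective complex. -/
lemma exists_quasiIso_isKProjective [EnoughProjectives C] [HasColimitsOfShape (Discrete ℕ) C]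
    [HasExactColimitsOfShape (Discrete ℕ) C] (K : CochainComplex C ℤ) :
    ∃ (L : CochainComplex C ℤ) (i : L ⟶ K), QuasiIso i ∧ L.IsKProjective := by
  have := preservesEpimorphisms_lim_op (C := C)
  obtain ⟨L, i, hi, hL, _⟩ := exists_quasiIso_isKInjective ((opEquivalence C).functor.obj (op K))
  let P := ((opEquivalence C).inverse.obj L).unop
  let e : (opEquivalence C).functor.obj (op P) ≅ L := (opEquivalence C).counitIso.app L
  obtain ⟨j, hj⟩ := (opEquivalence C).functor.map_surjective (i ≫ e.inv)
  refine ⟨P, j.unop, quasiIso_of_opEquivalence _ ?_,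
    isKProjective_of_op (isKInjective_of_iso e.symm)⟩
  rw [Quiver.Hom.op_unop, hj]
  infer_instance

end CochainComplex

/-! ### K-injective complexes as a right derivability structure -/

namespace HomotopyCategory

section KInjective

variable (C : Type*) [Category* C] [Abelian C]

/-- The K-injective complexes, as a property of objects of the homotopy category. -/
def kInjective : ObjectProperty (HomotopyCategory C (ComplexShape.up ℤ)) :=
  fun K => CochainComplex.IsKInjective K.as

/-- The inclusion of the K-injective complexes in the homotopy category, as a localizer
morphism from the isomorphisms to the quasi-isomorphisms. -/
@[simps]
def kInjectiveLocalizerMorphism :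
    LocalizerMorphism (MorphismProperty.isomorphisms (kInjective C).FullSubcategory)
      (quasiIso C (ComplexShape.up ℤ)) where
  functor := (kInjective C).ι
  map _ _ f (_ : IsIso f) := by
    rw [MorphismProperty.inverseImage_iff, mem_quasiIso_iff]
    intro n
    infer_instance

variable {C}

lemma bijective_Qh_map_of_kInjective [HasDerivedCategory C]
    (K : HomotopyCategory C (ComplexShape.up ℤ)) (L : (kInjective C).FullSubcategory) :
    Function.Bijective (DerivedCategory.Qh.map : (K ⟶ L.obj) → _) :=
  have : CochainComplex.IsKInjective L.obj.as := L.property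
  CochainComplex.IsKInjective.Qh_map_bijective K L.obj.as

/-- Invert `s` in the derived category, then lift back using K-injectivity of the target. -/
lemma exists_lift_of_kInjective {K K' : HomotopyCategory C (ComplexShape.up ℤ)}
    (s : K ⟶ K') (hs : quasiIso C (ComplexShape.up ℤ) s)
    (L : (kInjective C).FullSubcategory) (f : K ⟶ L.obj) : ∃ g : K' ⟶ L.obj, s ≫ g = f := by
  let := HasDerivedCategory.standard C
  have := Localization.inverts DerivedCategory.Qh _ _ hs
  obtain ⟨g, hg⟩ := (bijective_Qh_map_of_kInjective K' L).surjective
    (inv (DerivedCategory.Qh.map s) ≫ DerivedCategory.Qh.map f)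
  exact ⟨g, (bijective_Qh_map_of_kInjective K L).injective (by simp [hg])⟩

/-- The source carries only isomorphisms as weak equivalences, so every functor on the homotopy
category can be derived. -/
lemma kInjectiveLocalizerMorphism_derives {H : Type*} [Category* H]
    (F : HomotopyCategory C (ComplexShape.up ℤ) ⥤ H) :
    (kInjectiveLocalizerMorphism C).Derives F := fun _ _ f (_ : IsIso f) =>
  inferInstanceAs (IsIso (((kInjective C).ι ⋙ F).map f))

variable [EnoughInjectives C] [HasLimitsOfShape (Discrete ℕ) C]
  [(lim : (Discrete ℕ ⥤ C) ⥤ C).PreservesEpimorphisms]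

instance : (kInjectiveLocalizerMorphism C).HasRightResolutions := fun K => by
  obtain ⟨L, i, hi, hL, _⟩ := CochainComplex.exists_quasiIso_isKInjective K.as
  exact ⟨{
    X₁ := ⟨(quotient _ _).obj L, hL⟩
    w := (quotient _ _).map i
    hw := (quotient_map_mem_quasiIso_iff i).2 hi }⟩

instance (K : HomotopyCategory C (ComplexShape.up ℤ)) :
    IsConnected ((kInjectiveLocalizerMorphism C).RightResolution K) := by
  have : Nonempty ((kInjectiveLocalizerMorphism C).RightResolution K) := inferInstance
  refine zigzag_isConnected fun R R' => ?_
  obtain ⟨g, hg⟩ := exists_lift_of_kInjective R.w R.hw R'.X₁ R'.w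
  exact Zigzag.of_hom { f := ObjectProperty.homMk g, comm := hg }

instance : (kInjectiveLocalizerMorphism C).arrow.HasRightResolutions := fun f => by
  let R : (kInjectiveLocalizerMorphism C).RightResolution f.left := Classical.arbitrary _
  let R' : (kInjectiveLocalizerMorphism C).RightResolution f.right := Classical.arbitrary _
  obtain ⟨g, hg⟩ := exists_lift_of_kInjective R.w R.hw R'.X₁ (f.hom ≫ R'.w)
  exact ⟨{
    X₁ := Arrow.mk (ObjectProperty.homMk g : R.X₁ ⟶ R'.X₁)
    w := Arrow.homMk R.w R'.w hg
    hw := ⟨R.hw, R'.hw⟩ }⟩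

instance : (kInjectiveLocalizerMorphism C).IsLocalizedEquivalence := by
  let := HasDerivedCategory.standard C
  let F := (kInjective C).ι ⋙ DerivedCategory.Qh
  have : F.EssSurj :=
    (kInjectiveLocalizerMorphism C).essSurj_of_hasRightResolutions DerivedCategory.Qh
  have : F.Full := ⟨fun {K L} f => by
    obtain ⟨g, hg⟩ := (bijective_Qh_map_of_kInjective K.obj L).surjective f
    exact ⟨ObjectProperty.homMk g, hg⟩⟩
  have : F.Faithful := ⟨fun {K L} f g h =>
    ObjectProperty.hom_ext _ ((bijective_Qh_map_of_kInjective K.obj L).injective h)⟩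
  have : F.IsEquivalence := { }
  have : ((kInjectiveLocalizerMorphism C).functor ⋙ DerivedCategory.Qh).IsLocalization
      (MorphismProperty.isomorphisms (kInjective C).FullSubcategory) :=
    Functor.IsLocalization.of_isEquivalence F _ le_rfl
  exact LocalizerMorphism.IsLocalizedEquivalence.of_isLocalization_of_isLocalization _
    DerivedCategory.Qh

instance : (kInjectiveLocalizerMorphism C).IsRightDerivabilityStructure :=
  LocalizerMorphism.IsRightDerivabilityStructure.mk' _

end KInjective

end HomotopyCategory

/-! ### Adjunctions on complexes and derived categories -/

namespace CategoryTheory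

section Adjunction

variable {C₁ C₂ : Type*} [Category* C₁] [Category* C₂] [Preadditive C₁] [Preadditive C₂]
  {G : C₁ ⥤ C₂} {H : C₂ ⥤ C₁} [G.Additive] [H.Additive] (adj : G ⊣ H)

open HomologicalComplex

/-- The adjunction on complexes induced by an adjunction of additive functors. -/
@[simps]
def Adjunction.mapCochainComplex :
    G.mapHomologicalComplex (ComplexShape.up ℤ) ⊣ H.mapHomologicalComplex (ComplexShape.up ℤ) where
  unit :=
    { app := fun K =>
        { f := fun n => adj.unit.app (K.X n)
          comm' := fun i j _ => (adj.unit.naturality (K.d i j)).symm }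
      naturality := fun _ _ f => by ext n; exact adj.unit.naturality (f.f n) }
  counit :=
    { app := fun K =>
        { f := fun n => adj.counit.app (K.X n)
          comm' := fun i j _ => (adj.counit.naturality (K.d i j)).symm }
      naturality := fun _ _ f => by ext n; exact adj.counit.naturality (f.f n) }
  left_triangle_components K := by ext n; exact adj.left_triangle_components (K.X n)
  right_triangle_components K := by ext n; exact adj.right_triangle_components (K.X n)

/-- The adjunction on homotopy categories induced by an adjunction of additive functors. -/
@[simps]
def Adjunction.mapHomotopyCategory :
    G.mapHomotopyCategory (ComplexShape.up ℤ) ⊣ H.mapHomotopyCategory (ComplexShape.up ℤ) where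
  unit :=
    { app := fun K => (HomotopyCategory.quotient _ _).map (adj.mapCochainComplex.unit.app K.as)
      naturality := by
        intro K L f
        obtain ⟨f, rfl⟩ := (HomotopyCategory.quotient _ _).map_surjective f
        exact ((HomotopyCategory.quotient _ _).map_comp _ _).symm.trans
          ((congrArg (HomotopyCategory.quotient _ _).map
            (adj.mapCochainComplex.unit.naturality f)).trans
              ((HomotopyCategory.quotient _ _).map_comp _ _)) }
  counit :=
    { app := fun K => (HomotopyCategory.quotient _ _).map (adj.mapCochainComplex.counit.app K.as)
      naturality := by
        intro K L f
        obtain ⟨f, rfl⟩ := (HomotopyCategory.quotient _ _).map_surjective f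
        exact ((HomotopyCategory.quotient _ _).map_comp _ _).symm.trans
          ((congrArg (HomotopyCategory.quotient _ _).map
            (adj.mapCochainComplex.counit.naturality f)).trans
              ((HomotopyCategory.quotient _ _).map_comp _ _)) }
  left_triangle_components K :=
    ((HomotopyCategory.quotient _ _).map_comp _ _).symm.trans
      ((congrArg (HomotopyCategory.quotient _ _).map
        (adj.mapCochainComplex.left_triangle_components K.as)).trans
          ((HomotopyCategory.quotient _ _).map_id _))
  right_triangle_components K :=
    ((HomotopyCategory.quotient _ _).map_comp _ _).symm.trans
      ((congrArg (HomotopyCategory.quotient _ _).map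
        (adj.mapCochainComplex.right_triangle_components K.as)).trans
          ((HomotopyCategory.quotient _ _).map_id _))

end Adjunction

section DerivedAdjunction

variable {C₁ C₂ : Type*} [Category* C₁] [Category* C₂] [Abelian C₁] [Abelian C₂]
  [HasDerivedCategory.{w₁} C₁] [HasDerivedCategory.{w₂} C₂]
  {G : C₁ ⥤ C₂} {H : C₂ ⥤ C₁} [G.Additive] [H.Additive] (adj : G ⊣ H)
  [PreservesFiniteLimits G] [PreservesFiniteColimits G]
  [EnoughInjectives C₂] [HasLimitsOfShape (Discrete ℕ) C₂]
  [(lim : (Discrete ℕ ⥤ C₂) ⥤ C₂).PreservesEpimorphisms]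
  {RH : DerivedCategory C₂ ⥤ DerivedCategory C₁}
  (β : H.mapHomotopyCategory (ComplexShape.up ℤ) ⋙ DerivedCategory.Qh ⟶ DerivedCategory.Qh ⋙ RH)
  [RH.IsRightDerivedFunctor β (HomotopyCategory.quasiIso C₂ (ComplexShape.up ℤ))]

/-- The unit `β` is invertible on K-injectives and stays so after applying a functor, which
characterises right derived functors here. The derived adjunction needs this compatibility. -/
lemma isRightDerivedFunctor_comp_mapDerivedCategory :
    (RH ⋙ G.mapDerivedCategory).IsRightDerivedFunctor
      (Functor.whiskerRight β G.mapDerivedCategory ≫ (Functor.associator _ _ _).hom)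
      (HomotopyCategory.quasiIso C₂ (ComplexShape.up ℤ)) :=
  (HomotopyCategory.kInjectiveLocalizerMorphism_derives _).isRightDerivedFunctor_of_isIso _
    fun X => by
      have := (HomotopyCategory.kInjectiveLocalizerMorphism_derives
        (H.mapHomotopyCategory (ComplexShape.up ℤ) ⋙
          DerivedCategory.Qh)).isIso_of_isRightDerivedFunctor β X
      rw [NatTrans.comp_app, Functor.whiskerRight_app]
      infer_instance

/-- The total right derived functor of a right adjoint of an exact functor `G` is right adjoint to
the functor induced by `G` on derived categories. -/
noncomputable def Adjunction.mapDerivedCategory : G.mapDerivedCategory ⊣ RH :=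
  have := Functor.isLeftDerivedFunctor_of_inverts
    (HomotopyCategory.quasiIso C₁ (ComplexShape.up ℤ)) G.mapDerivedCategory
      G.mapDerivedCategoryFactorsh
  have : (G.mapDerivedCategory ⋙ RH).IsLeftDerivedFunctor
      ((Functor.associator _ _ _).inv ≫ Functor.whiskerRight G.mapDerivedCategoryFactorsh.hom RH)
      (HomotopyCategory.quasiIso C₁ (ComplexShape.up ℤ)) :=
    Functor.isLeftDerivedFunctor_of_inverts _ (G.mapDerivedCategory ⋙ RH)
      ((Functor.associator _ _ _).symm ≪≫
        Functor.isoWhiskerRight G.mapDerivedCategoryFactorsh RH)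
  have := isRightDerivedFunctor_comp_mapDerivedCategory (G := G) β
  adj.mapHomotopyCategory.derived
    (HomotopyCategory.quasiIso C₁ (ComplexShape.up ℤ))
    (HomotopyCategory.quasiIso C₂ (ComplexShape.up ℤ)) G.mapDerivedCategoryFactorsh.hom β

lemma Adjunction.mapDerivedCategory_counit_app
    (K : HomotopyCategory C₂ (ComplexShape.up ℤ)) :
    G.mapDerivedCategory.map (β.app K) ≫
      (adj.mapDerivedCategory β).counit.app (DerivedCategory.Qh.obj K) =
    G.mapDerivedCategoryFactorsh.hom.app
        ((H.mapHomotopyCategory (ComplexShape.up ℤ)).obj K) ≫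
      DerivedCategory.Qh.map (adj.mapHomotopyCategory.counit.app K) :=
  have := isRightDerivedFunctor_comp_mapDerivedCategory (G := G) β
  adj.mapHomotopyCategory.derivedε_fac_app (HomotopyCategory.quasiIso C₂ (ComplexShape.up ℤ))
    G.mapDerivedCategoryFactorsh.hom β K

end DerivedAdjunction

/-! ### Left adjoints via K-projective resolutions -/

section LeftAdjoint

section

variable {K₁ K₂ D₁ D₂ : Type*} [Category* K₁] [Category* K₂] [Category* D₁] [Category* D₂]
  {F : K₂ ⥤ K₁} {G : K₁ ⥤ K₂} (adj : F ⊣ G) {L₁ : K₁ ⥤ D₁} {L₂ : K₂ ⥤ D₂} {G' : D₁ ⥤ D₂}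
  (α : L₁ ⋙ G' ≅ G ⋙ L₂) [L₁.EssSurj] (X : K₂)

/-- Pointwise universal arrow: when both localizations are bijective on morphisms out of `X` and
`F.obj X`, the bijection of `adj` passes to the localized categories. -/
lemma Adjunction.existsUnique_map_eq_of_bijective
    (h₂ : ∀ Y, Function.Bijective (L₂.map : (X ⟶ Y) → _))
    (h₁ : ∀ Y, Function.Bijective (L₁.map : (F.obj X ⟶ Y) → _))
    (Z : D₁) (f : L₂.obj X ⟶ G'.obj Z) :
    ∃! φ : L₁.obj (F.obj X) ⟶ Z,
      L₂.map (adj.unit.app X) ≫ α.inv.app (F.obj X) ≫ G'.map φ = f := by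
  let e := L₁.objObjPreimageIso Z
  have key (φ : F.obj X ⟶ L₁.objPreimage Z) :
      L₂.map (adj.unit.app X) ≫ α.inv.app (F.obj X) ≫ G'.map (L₁.map φ) =
        L₂.map (adj.homEquiv _ _ φ) ≫ α.inv.app _ := by
    have h := α.inv.naturality φ
    dsimp at h
    rw [Adjunction.homEquiv_unit, Functor.map_comp, Category.assoc, h]
  obtain ⟨g, hg⟩ := (h₂ _).surjective (f ≫ G'.map e.inv ≫ α.hom.app _)
  refine ⟨L₁.map ((adj.homEquiv _ _).symm g) ≫ e.hom, ?_, fun ψ hψ => ?_⟩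
  · dsimp only
    rw [Functor.map_comp, reassoc_of% (key ((adj.homEquiv _ _).symm g)),
      Equiv.apply_symm_apply, hg]
    simp [← Functor.map_comp]
  · obtain ⟨ψ', hψ'⟩ := (h₁ _).surjective (ψ ≫ e.inv)
    have h' : ψ' = (adj.homEquiv _ _).symm g := by
      rw [Equiv.eq_symm_apply]
      apply (h₂ _).injective
      rw [hg, ← cancel_mono (α.inv.app _), ← hψ, ← key ψ', hψ']
      simp
    rw [← h', hψ', Category.assoc, Iso.inv_hom_id, Category.comp_id]

include adj α in
lemma Adjunction.hasInitial_structuredArrow_of_bijective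
    (h₂ : ∀ Y, Function.Bijective (L₂.map : (X ⟶ Y) → _))
    (h₁ : ∀ Y, Function.Bijective (L₁.map : (F.obj X ⟶ Y) → _))
    {M : D₂} (e : L₂.obj X ≅ M) : HasInitial (StructuredArrow M G') := by
  have h := adj.existsUnique_map_eq_of_bijective α X h₂ h₁
  let I : StructuredArrow M G' := StructuredArrow.mk (Y := L₁.obj (F.obj X))
    (e.inv ≫ L₂.map (adj.unit.app X) ≫ α.inv.app (F.obj X))
  have hI : IsInitial I := IsInitial.ofUniqueHom
    (fun Z => StructuredArrow.homMk (h Z.right (e.hom ≫ Z.hom)).choose (by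
      have := (h Z.right (e.hom ≫ Z.hom)).choose_spec.1
      dsimp only at this
      simp [I, this]))
    (fun Z m => by
      ext
      refine (h Z.right (e.hom ≫ Z.hom)).choose_spec.2 _ ?_
      rw [← StructuredArrow.w m]
      simp [I])
  exact hI.hasInitial

end

variable {C₁ C₂ : Type*} [Category* C₁] [Category* C₂] [Abelian C₁] [Abelian C₂]
  {F : C₂ ⥤ C₁} {G : C₁ ⥤ C₂} [F.Additive] [G.Additive] (adj : F ⊣ G)
  [PreservesFiniteLimits G] [PreservesFiniteColimits G]

lemma Functor.mapHomologicalComplex_obj_acyclic {K : CochainComplex C₁ ℤ} (hK : K.Acyclic) :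
    ((G.mapHomologicalComplex (ComplexShape.up ℤ)).obj K).Acyclic := fun n =>
  ShortComplex.Exact.map (hK n) G

-- Maps from the image of `P` to an acyclic complex correspond to maps from `P` to its image under
-- `G`, acyclic by exactness.
include adj in
lemma Adjunction.isKProjective_mapHomologicalComplex_obj (P : CochainComplex C₂ ℤ)
    [P.IsKProjective] :
    CochainComplex.IsKProjective ((F.mapHomologicalComplex (ComplexShape.up ℤ)).obj P) := by
  rw [CochainComplex.isKProjective_iff_leftOrthogonal]
  intro N f hN
  obtain ⟨N, rfl⟩ := HomotopyCategory.quotient_obj_surjective N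
  rw [HomotopyCategory.quotient_obj_mem_subcategoryAcyclic_iff_acyclic] at hN
  apply (adj.mapHomotopyCategory.homEquiv ((HomotopyCategory.quotient _ _).obj P)
    ((HomotopyCategory.quotient _ _).obj N)).injective
  refine (CochainComplex.IsKProjective.leftOrthogonal P _ ?_).trans
    (CochainComplex.IsKProjective.leftOrthogonal P _ ?_).symm <;>
  exact (HomotopyCategory.quotient_obj_mem_subcategoryAcyclic_iff_acyclic _).2
    (Functor.mapHomologicalComplex_obj_acyclic hN)

variable [HasDerivedCategory.{w₁} C₁] [HasDerivedCategory.{w₂} C₂]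

include adj in
/-- The functor induced on derived categories by an exact functor which is a right adjoint has a
left adjoint, if K-projective resolutions exist. -/
lemma Adjunction.isRightAdjoint_mapDerivedCategory [EnoughProjectives C₂]
    [HasColimitsOfShape (Discrete ℕ) C₂] [HasExactColimitsOfShape (Discrete ℕ) C₂] :
    G.mapDerivedCategory.IsRightAdjoint := by
  rw [isRightAdjoint_iff_hasInitial_structuredArrow]
  intro M
  obtain ⟨K, ⟨e⟩⟩ : ∃ K, Nonempty (M ≅ DerivedCategory.Q.obj K) :=
    ⟨_, ⟨(DerivedCategory.Q.objObjPreimageIso M).symm⟩⟩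
  obtain ⟨P, i, hi, hP⟩ := CochainComplex.exists_quasiIso_isKProjective K
  let e' : DerivedCategory.Qh.obj ((HomotopyCategory.quotient _ _).obj P) ≅ M :=
    (DerivedCategory.quotientCompQhIso C₂).app P ≪≫ asIso (DerivedCategory.Q.map i) ≪≫ e.symm
  have := adj.isKProjective_mapHomologicalComplex_obj P
  exact adj.mapHomotopyCategory.hasInitial_structuredArrow_of_bijective
    G.mapDerivedCategoryFactorsh _ (fun Y => CochainComplex.IsKProjective.Qh_map_bijective P Y)
    (fun Y => CochainComplex.IsKProjective.Qh_map_bijective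
      ((F.mapHomologicalComplex (ComplexShape.up ℤ)).obj P) Y) e'

end LeftAdjoint

end CategoryTheory

/-! ### Descent of natural transformations, and the counit on cochain complexes -/

open DerivedCategory

namespace CategoryTheory

/-- Each morphism between images of `L` lifts, so naturality of `τ` covers it. Faithfulness is
unnecessary because `F` and `G` already live on `D`; homotopic chain maps therefore do no harm. -/
lemma Functor.exists_natTrans_of_full_of_essSurj {C D E : Type*} [Category* C] [Category* D]
    [Category* E] (L : C ⥤ D) [L.Full] [L.EssSurj] {F G : D ⥤ E} (τ : L ⋙ F ⟶ L ⋙ G) :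
    ∃ σ : F ⟶ G, ∀ X, σ.app (L.obj X) = τ.app X := by
  have key {X Y : C} (f : L.obj X ⟶ L.obj Y) :
      F.map f ≫ τ.app Y = τ.app X ≫ G.map f := by
    obtain ⟨f, rfl⟩ := L.map_surjective f
    exact τ.naturality f
  refine ⟨{
    app := fun Y => F.map (L.objObjPreimageIso Y).inv ≫ τ.app _ ≫
      G.map (L.objObjPreimageIso Y).hom
    naturality := fun Y Z f => ?_ }, fun X => ?_⟩
  · have := key ((L.objObjPreimageIso Y).hom ≫ f ≫ (L.objObjPreimageIso Z).inv)
    simp only [Functor.map_comp, Category.assoc] at this ⊢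
    rw [← cancel_epi (F.map (L.objObjPreimageIso Y).hom), reassoc_of% this]
    simp [← Functor.map_comp, ← Functor.map_comp_assoc]
  · dsimp only
    rw [← key, ← Functor.map_comp_assoc]
    simp

section

variable {C₁ C₂ : Type*} [Category* C₁] [Category* C₂] [Abelian C₁] [Abelian C₂]
  [HasDerivedCategory.{w₁} C₁] [HasDerivedCategory.{w₂} C₂]
  {H : C₂ ⥤ C₁} [H.Additive] {RH : DerivedCategory C₂ ⥤ DerivedCategory C₁}
  (β : H.mapHomotopyCategory (ComplexShape.up ℤ) ⋙ DerivedCategory.Qh ⟶ DerivedCategory.Qh ⋙ RH)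

/-- The restriction to cochain complexes of a natural transformation defined on the homotopy
category. -/
def natTransOfHomotopyCategory :
    (H.mapHomologicalComplex (ComplexShape.up ℤ) ⋙ HomotopyCategory.quotient _ _) ⋙ Qh ⟶
      (HomotopyCategory.quotient _ _ ⋙ Qh) ⋙ RH where
  app K := β.app ((HomotopyCategory.quotient _ _).obj K)
  naturality _ _ f := β.naturality ((HomotopyCategory.quotient _ _).map f)

/-- The natural transformation on cochain complexes induced by the unit of a right derived
functor defined on the homotopy category. -/
@[simps]
noncomputable def rightDerivedUnitOfComplexes :
    H.mapHomologicalComplex (ComplexShape.up ℤ) ⋙ Q (C := C₁) ⟶ Q (C := C₂) ⋙ RH where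
  app K := (quotientCompQhIso C₁).inv.app _ ≫
    (natTransOfHomotopyCategory β).app K ≫ RH.map ((quotientCompQhIso C₂).hom.app K)
  naturality K L f := by
    have h₁ := (quotientCompQhIso C₁).inv.naturality
      ((H.mapHomologicalComplex (ComplexShape.up ℤ)).map f)
    have h₂ := (natTransOfHomotopyCategory β).naturality f
    have h₃ := RH.congr_map ((quotientCompQhIso C₂).hom.naturality f)
    dsimp at h₁ h₂ h₃ ⊢
    simp only [Functor.map_comp] at h₃
    rw [reassoc_of% h₁, Category.assoc, Category.assoc, ← h₃, reassoc_of% h₂]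

lemma isIso_rightDerivedUnitOfComplexes_app [EnoughInjectives C₂]
    [HasLimitsOfShape (Discrete ℕ) C₂] [(lim : (Discrete ℕ ⥤ C₂) ⥤ C₂).PreservesEpimorphisms]
    [RH.IsRightDerivedFunctor β (HomotopyCategory.quasiIso C₂ (ComplexShape.up ℤ))]
    (I : CochainComplex C₂ ℤ) [I.IsKInjective] :
    IsIso ((rightDerivedUnitOfComplexes β).app I) := by
  have : IsIso ((natTransOfHomotopyCategory β).app I) :=
    (HomotopyCategory.kInjectiveLocalizerMorphism_derives
      (H.mapHomotopyCategory (ComplexShape.up ℤ) ⋙ Qh)).isIso_of_isRightDerivedFunctor β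
        ⟨(HomotopyCategory.quotient _ _).obj I, ‹_›⟩
  rw [rightDerivedUnitOfComplexes_app]
  infer_instance

variable {G : C₁ ⥤ C₂} [G.Additive] (adj : G ⊣ H)
  [PreservesFiniteLimits G] [PreservesFiniteColimits G]
  [EnoughInjectives C₂] [HasLimitsOfShape (Discrete ℕ) C₂]
  [(lim : (Discrete ℕ ⥤ C₂) ⥤ C₂).PreservesEpimorphisms]
  [RH.IsRightDerivedFunctor β (HomotopyCategory.quasiIso C₂ (ComplexShape.up ℤ))]

lemma Adjunction.mapDerivedCategory_counit_app_Q (K : CochainComplex C₂ ℤ) :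
    G.mapDerivedCategory.map ((rightDerivedUnitOfComplexes β).app K) ≫
      (adj.mapDerivedCategory β).counit.app (Q.obj K) =
    G.mapDerivedCategoryFactors.hom.app
        ((H.mapHomologicalComplex (ComplexShape.up ℤ)).obj K) ≫
      Q.map (adj.mapCochainComplex.counit.app K) := by
  have h₁ := (adj.mapDerivedCategory β).counit.naturality ((quotientCompQhIso C₂).hom.app K)
  have h₂ := adj.mapDerivedCategory_counit_app β ((HomotopyCategory.quotient _ _).obj K)
  have h₃ := (quotientCompQhIso C₂).hom.naturality (adj.mapCochainComplex.counit.app K)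
  have h₄ := G.mapDerivedCategoryFactorsh_hom_app
    ((H.mapHomologicalComplex (ComplexShape.up ℤ)).obj K)
  replace h₂ : G.mapDerivedCategory.map ((natTransOfHomotopyCategory β).app K) ≫
      (adj.mapDerivedCategory β).counit.app (Qh.obj ((HomotopyCategory.quotient _ _).obj K)) =
    G.mapDerivedCategoryFactorsh.hom.app ((HomotopyCategory.quotient _ _).obj
      ((H.mapHomologicalComplex (ComplexShape.up ℤ)).obj K)) ≫
      Qh.map ((G.mapHomotopyCategoryFactors (ComplexShape.up ℤ)).hom.app _) ≫
      Qh.map ((HomotopyCategory.quotient _ _).map (adj.mapCochainComplex.counit.app K)) := by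
    refine h₂.trans (congrArg _ ?_)
    rw [← Functor.map_comp]
    -- The inserted component of `mapHomotopyCategoryFactors` is an identity.
    exact congrArg _ (Category.id_comp _).symm
  dsimp at h₁ h₃ h₄
  rw [rightDerivedUnitOfComplexes_app, Functor.map_comp, Functor.map_comp, Category.assoc,
    Category.assoc]
  erw [h₁, reassoc_of% h₂]
  rw [h₃]
  erw [h₄]
  simp [← Functor.map_comp_assoc]

end

end CategoryTheory

/-! ### The functorial triangle -/

namespace CategoryTheory

lemma Pretriangulated.mk_mem_distTriang_of_iso {D : Type*} [Category* D] [Preadditive D]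
    [HasZeroObject D] [HasShift D ℤ] [∀ n : ℤ, (shiftFunctor D n).Additive] [Pretriangulated D]
    {X Y Z X' Y' Z' : D} {f : X ⟶ Y} {g : Y ⟶ Z} {h : Z ⟶ X⟦(1 : ℤ)⟧}
    (hT : Triangle.mk f g h ∈ distTriang D)
    {f' : X' ⟶ Y'} {g' : Y' ⟶ Z'} {h' : Z' ⟶ X'⟦(1 : ℤ)⟧}
    (e₁ : X ≅ X') (e₂ : Y ≅ Y') (e₃ : Z ≅ Z') (hf : f ≫ e₂.hom = e₁.hom ≫ f')
    (hg : g ≫ e₃.hom = e₂.hom ≫ g') (hh : h ≫ e₁.hom⟦1⟧' = e₃.hom ≫ h') :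
    Triangle.mk f' g' h' ∈ distTriang D :=
  isomorphic_distinguished _ hT _ (Triangle.isoMk _ _ e₁ e₂ e₃ hf hg hh).symm

section

variable (C : Type*) [Category* C] [Abelian C]

/-- The K-injective cochain complexes of injective objects. -/
def termwiseKInjective : ObjectProperty (CochainComplex C ℤ) :=
  fun K => K.IsKInjective ∧ ∀ n, Injective (K.X n)

variable [HasDerivedCategory.{w₁} C]

/-- The functor from K-injective complexes of injective objects to the derived category. -/
noncomputable abbrev termwiseKInjectiveQ :
    (termwiseKInjective C).FullSubcategory ⥤ DerivedCategory C :=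
  (termwiseKInjective C).ι ⋙ Q

instance : (termwiseKInjectiveQ C).Full where
  map_surjective {K L} f := by
    have := L.property.1
    obtain ⟨g, hg⟩ := CochainComplex.IsKInjective.Q_map_surjective K.obj L.obj f
    exact ⟨ObjectProperty.homMk g, hg⟩

instance [EnoughInjectives C] [HasLimitsOfShape (Discrete ℕ) C]
    [(lim : (Discrete ℕ ⥤ C) ⥤ C).PreservesEpimorphisms] : (termwiseKInjectiveQ C).EssSurj where
  mem_essImage Y := by
    obtain ⟨L, i, hi, hL⟩ := CochainComplex.exists_quasiIso_isKInjective (Q.objPreimage Y)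
    exact ⟨⟨L, hL⟩, ⟨(asIso (Q.map i)).symm ≪≫ Q.objObjPreimageIso Y⟩⟩

end

section

variable {C₁ C₂ : Type*} [Category* C₁] [Category* C₂] [Abelian C₁] [Abelian C₂]
  {H : C₂ ⥤ C₁} [H.Additive] {G : C₁ ⥤ C₂} [G.Additive] (adj : G ⊣ H)
  {T : C₂ ⥤ C₂} [T.Additive] (γ : 𝟭 C₂ ⟶ T)

/-- The morphism of cochain complexes induced by a natural transformation from the identity. -/
@[simps]
def cochainComplexUnit : 𝟭 (CochainComplex C₂ ℤ) ⟶ T.mapHomologicalComplex (ComplexShape.up ℤ) where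
  app K :=
    { f := fun n => γ.app (K.X n)
      comm' := fun i j _ => (γ.naturality (K.d i j)).symm }
  naturality _ _ f := by
    ext n
    exact γ.naturality (f.f n)

variable (zero : ∀ M, adj.counit.app M ≫ γ.app M = 0)

/-- The short complex `G H K ⟶ K ⟶ T K` of cochain complexes. -/
@[simps]
def twistShortComplex (K : CochainComplex C₂ ℤ) : ShortComplex (CochainComplex C₂ ℤ) where
  f := adj.mapCochainComplex.counit.app K
  g := (cochainComplexUnit γ).app K
  zero := by
    ext n
    exact zero (K.X n)

/-- The functoriality of `twistShortComplex`. -/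
@[simps]
def twistShortComplexMap {K L : CochainComplex C₂ ℤ} (φ : K ⟶ L) :
    twistShortComplex adj γ zero K ⟶ twistShortComplex adj γ zero L where
  τ₁ := (G.mapHomologicalComplex _).map ((H.mapHomologicalComplex _).map φ)
  τ₂ := φ
  τ₃ := (T.mapHomologicalComplex _).map φ
  comm₁₂ := adj.mapCochainComplex.counit.naturality φ
  comm₂₃ := (cochainComplexUnit γ).naturality φ

lemma shortExact_twistShortComplex
    (hS : ∀ M [Injective M], (ShortComplex.mk _ _ (zero M)).ShortExact)
    (K : CochainComplex C₂ ℤ) [∀ n, Injective (K.X n)] :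
    (twistShortComplex adj γ zero K).ShortExact :=
  HomologicalComplex.shortExact_of_degreewise_shortExact _ fun n => hS (K.X n)

variable [HasDerivedCategory.{w₁} C₁] [HasDerivedCategory.{w₂} C₂]
  [PreservesFiniteLimits G] [PreservesFiniteColimits G]
  [EnoughInjectives C₂] [HasLimitsOfShape (Discrete ℕ) C₂]
  [(lim : (Discrete ℕ ⥤ C₂) ⥤ C₂).PreservesEpimorphisms]
  {RH : DerivedCategory C₂ ⥤ DerivedCategory C₁}
  (β : H.mapHomotopyCategory (ComplexShape.up ℤ) ⋙ DerivedCategory.Qh ⟶ DerivedCategory.Qh ⋙ RH)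
  [RH.IsRightDerivedFunctor β (HomotopyCategory.quasiIso C₂ (ComplexShape.up ℤ))]
  {RT : DerivedCategory C₂ ⥤ DerivedCategory C₂}
  (βT : T.mapHomotopyCategory (ComplexShape.up ℤ) ⋙ DerivedCategory.Qh ⟶ DerivedCategory.Qh ⋙ RT)
  [RT.IsRightDerivedFunctor βT (HomotopyCategory.quasiIso C₂ (ComplexShape.up ℤ))]

-- Uniqueness of right adjoints compares `R` with `RH`, so the counit of any right adjoint is
-- computed by the termwise counit on K-injective complexes.
include β in
lemma exists_iso_of_rightAdjoint_mapDerivedCategory {R : DerivedCategory C₂ ⥤ DerivedCategory C₁}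
    (adj' : G.mapDerivedCategory ⊣ R) :
    ∃ e : (H.mapHomologicalComplex (ComplexShape.up ℤ) ⋙
          G.mapHomologicalComplex (ComplexShape.up ℤ)) ⋙ Q ⟶
        Q ⋙ R ⋙ G.mapDerivedCategory,
      (∀ K, e.app K ≫ adj'.counit.app (Q.obj K) =
        Q.map (adj.mapCochainComplex.counit.app K)) ∧
      ∀ (K : CochainComplex C₂ ℤ) [K.IsKInjective], IsIso (e.app K) := by
  let φ := (adj.mapDerivedCategory β).rightAdjointUniq adj'
  let e : (H.mapHomologicalComplex (ComplexShape.up ℤ) ⋙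
        G.mapHomologicalComplex (ComplexShape.up ℤ)) ⋙ Q ⟶ Q ⋙ R ⋙ G.mapDerivedCategory :=
    { app := fun K => G.mapDerivedCategoryFactors.inv.app _ ≫
        G.mapDerivedCategory.map ((rightDerivedUnitOfComplexes β).app K ≫ φ.hom.app (Q.obj K))
      naturality := fun K L f => by
        have h₁ := G.mapDerivedCategoryFactors.inv.naturality
          ((H.mapHomologicalComplex (ComplexShape.up ℤ)).map f)
        have h₂ := (rightDerivedUnitOfComplexes β).naturality f
        have h₃ := φ.hom.naturality (Q.map f)
        dsimp [-rightDerivedUnitOfComplexes_app] at h₁ h₂ h₃ ⊢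
        rw [reassoc_of% h₁, Category.assoc, ← Functor.map_comp, ← Functor.map_comp,
          Category.assoc, reassoc_of% h₂, h₃] }
  refine ⟨e, fun K => ?_, fun K _ => ?_⟩
  · have h := adj.mapDerivedCategory_counit_app_Q β K
    have h' := Adjunction.rightAdjointUniq_hom_app_counit (adj.mapDerivedCategory β) adj' (Q.obj K)
    dsimp [e, -rightDerivedUnitOfComplexes_app]
    rw [Functor.map_comp, Category.assoc, Category.assoc, h', h, Iso.inv_hom_id_app_assoc]
  · have := isIso_rightDerivedUnitOfComplexes_app β K
    dsimp only [e]
    infer_instance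

include adj β βT zero in
/-- If `G H M ⟶ M ⟶ T M` is a short exact sequence for every injective object `M`, then the right
derived functor of `T` is a cone of the counit on derived categories. -/
lemma exists_twist_triangle
    (hS : ∀ M [Injective M], (ShortComplex.mk _ _ (zero M)).ShortExact)
    {R : DerivedCategory C₂ ⥤ DerivedCategory C₁} (adj' : G.mapDerivedCategory ⊣ R) :
    ∃ (u : 𝟭 (DerivedCategory C₂) ⟶ RT)
      (w : RT ⟶ (R ⋙ G.mapDerivedCategory) ⋙ shiftFunctor _ (1 : ℤ)), ∀ a,
      Triangle.mk (adj'.counit.app a) (u.app a) (w.app a) ∈ distTriang _ := by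
  obtain ⟨e, he, he'⟩ := exists_iso_of_rightAdjoint_mapDerivedCategory adj β adj'
  have hI (I : (termwiseKInjective C₂).FullSubcategory) :
      (twistShortComplex adj γ zero I.obj).ShortExact :=
    have := I.property.2
    shortExact_twistShortComplex adj γ zero hS I.obj
  have hT (I : (termwiseKInjective C₂).FullSubcategory) :
      IsIso ((rightDerivedUnitOfComplexes βT).app I.obj) :=
    have := I.property.1
    isIso_rightDerivedUnitOfComplexes_app βT I.obj
  let u₀ : termwiseKInjectiveQ C₂ ⋙ 𝟭 _ ⟶ termwiseKInjectiveQ C₂ ⋙ RT :=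
    { app := fun I => Q.map ((cochainComplexUnit γ).app I.obj) ≫
        (rightDerivedUnitOfComplexes βT).app I.obj
      naturality := fun I J f => by
        have h₁ := Q.congr_map ((cochainComplexUnit γ).naturality f.hom)
        have h₂ := (rightDerivedUnitOfComplexes βT).naturality f.hom
        dsimp [-rightDerivedUnitOfComplexes_app, -cochainComplexUnit_app_f] at h₁ h₂ ⊢
        rw [Functor.map_comp, Functor.map_comp] at h₁
        rw [reassoc_of% h₁, h₂, Category.assoc] }
  -- The connecting morphism is natural in maps of short exact sequences; this makes the third map
  -- of the triangle functorial.
  obtain ⟨δ, hδ⟩ : ∃ δ : (termwiseKInjective C₂).ι ⋙ T.mapHomologicalComplex _ ⋙ Q ⟶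
      (termwiseKInjective C₂).ι ⋙ ((H.mapHomologicalComplex _ ⋙ G.mapHomologicalComplex _) ⋙
        Q) ⋙ shiftFunctor _ (1 : ℤ), ∀ I, δ.app I = triangleOfSESδ (hI I) :=
    ⟨{ app := fun I => triangleOfSESδ (hI I)
       naturality := fun I J f => (triangleOfSESδ_naturality (hI I) (hI J)
        (twistShortComplexMap adj γ zero f.hom)).symm }, fun _ => rfl⟩
  let w₀ : termwiseKInjectiveQ C₂ ⋙ RT ⟶
      termwiseKInjectiveQ C₂ ⋙ (R ⋙ G.mapDerivedCategory) ⋙ shiftFunctor _ (1 : ℤ) :=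
    { app := fun I => inv ((rightDerivedUnitOfComplexes βT).app I.obj) ≫
        δ.app I ≫ (e.app I.obj)⟦1⟧'
      naturality := fun I J f => by
        have h₁ := δ.naturality f
        have h₂ := (rightDerivedUnitOfComplexes βT).naturality f.hom
        have h₃ := (shiftFunctor (DerivedCategory C₂) (1 : ℤ)).congr_map (e.naturality f.hom)
        dsimp [-rightDerivedUnitOfComplexes_app] at h₁ h₂ h₃ ⊢
        rw [Functor.map_comp, Functor.map_comp] at h₃
        rw [Category.assoc, Category.assoc, ← h₃, ← reassoc_of% h₁,
          ← cancel_epi ((rightDerivedUnitOfComplexes βT).app I.obj), IsIso.hom_inv_id_assoc,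
          ← reassoc_of% h₂, IsIso.hom_inv_id_assoc] }
  obtain ⟨u, hu⟩ := (termwiseKInjectiveQ C₂).exists_natTrans_of_full_of_essSurj u₀
  obtain ⟨w, hw⟩ := (termwiseKInjectiveQ C₂).exists_natTrans_of_full_of_essSurj w₀
  refine ⟨u, w, fun a => ?_⟩
  let I := (termwiseKInjectiveQ C₂).objPreimage a
  let i : Q.obj I.obj ≅ a := (termwiseKInjectiveQ C₂).objObjPreimageIso a
  have := I.property.1
  have := he' I.obj
  have h₀ : Triangle.mk (Q.map (adj.mapCochainComplex.counit.app I.obj))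
      (Q.map ((cochainComplexUnit γ).app I.obj)) (δ.app I) ∈ distTriang _ := by
    rw [hδ]
    exact triangleOfSES_distinguished (hI I)
  let i₁ : Q.obj ((G.mapHomologicalComplex _).obj ((H.mapHomologicalComplex _).obj I.obj)) ≅
      (R ⋙ G.mapDerivedCategory).obj (Q.obj I.obj) := asIso (e.app I.obj)
  let i₃ : Q.obj ((T.mapHomologicalComplex _).obj I.obj) ≅ RT.obj (Q.obj I.obj) :=
    asIso ((rightDerivedUnitOfComplexes βT).app I.obj)
  refine mk_mem_distTriang_of_iso h₀ (i₁ ≪≫ (R ⋙ G.mapDerivedCategory).mapIso i) i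
    (i₃ ≪≫ RT.mapIso i) ?_ ?_ ?_
  · have h := adj'.counit.naturality i.hom
    have h' := he I.obj
    dsimp [i₁] at h h' ⊢
    erw [Category.assoc, h, reassoc_of% h']
  · have h := u.naturality i.hom
    have h' := hu I
    dsimp [u₀, i₃, -rightDerivedUnitOfComplexes_app] at h h' ⊢
    rw [h, h', Category.assoc]
  · have h := w.naturality i.hom
    have h' := hw I
    dsimp [w₀, i₁, i₃, -rightDerivedUnitOfComplexes_app] at h h' ⊢
    rw [Category.assoc, h, h']
    simp [-rightDerivedUnitOfComplexes_app]

end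

end CategoryTheory

/-! ### Bimodules attached to the ring morphism -/

namespace TwistRing

section RightDerived

variable (A B : Type u) [Ring A] [Ring B] (L : Type u) [AddCommGroup L]
  [Module B L] [Module Aᵐᵒᵖ L] [SMulCommClass B Aᵐᵒᵖ L]

instance hasRHom [HasDerivedCategory.{w₂} (ModuleCat.{u} Bᵐᵒᵖ)] : HasRHom.{w₂} A B L :=
  have := (HomotopyCategory.kInjectiveLocalizerMorphism_derives
    (bimoduleHomK.{w₂} A B L)).hasPointwiseRightDerivedFunctor
  inferInstance

variable [HasDerivedCategory.{w₁} (ModuleCat.{u} Aᵐᵒᵖ)]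
  [HasDerivedCategory.{w₂} (ModuleCat.{u} Bᵐᵒᵖ)]

/-- The canonical natural transformation from `Hom_A(L, -)` to `RHom_A(L, -)`. -/
noncomputable def rHomUnit :
    (bimoduleHom A B L).mapHomotopyCategory (ComplexShape.up ℤ) ⋙ DerivedCategory.Qh ⟶
      DerivedCategory.Qh ⋙ RHom.{w₁, w₂} A B L :=
  (bimoduleHomK.{w₂} A B L).totalRightDerivedUnit DerivedCategory.Qh
    (HomotopyCategory.quasiIso (ModuleCat.{u} Aᵐᵒᵖ) (ComplexShape.up ℤ))

instance : (RHom.{w₁, w₂} A B L).IsRightDerivedFunctor (rHomUnit.{w₁, w₂} A B L)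
    (HomotopyCategory.quasiIso (ModuleCat.{u} Aᵐᵒᵖ) (ComplexShape.up ℤ)) :=
  inferInstanceAs (((bimoduleHomK.{w₂} A B L).totalRightDerived _ _).IsRightDerivedFunctor
    ((bimoduleHomK.{w₂} A B L).totalRightDerivedUnit _ _) _)

end RightDerived

variable {A B : Type u} [Ring A] [Ring B] (p : A →+* B)

/-- Special adjoint functor theorem: limits are preserved and modules have a coseparator. -/
instance : (ModuleCat.restrictScalars.{u} (RingHom.op p)).IsRightAdjoint :=
  have : PreservesLimits (ModuleCat.restrictScalars.{u} (RingHom.op p)) :=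
    ⟨⟨inferInstance⟩⟩
  isRightAdjoint_of_preservesLimits_of_isCoseparating.{u} (isCoseparator_coseparator _) _

/-- The unit of `B`, seen as an element of the bimodule `B`. -/
def Target.one : Target p := (1 : B)

lemma op_smul_target_one (a : A) : MulOpposite.op a • Target.one p = (show Target p from p a) :=
  one_mul (p a)

/-- Evaluation at `1`, a morphism from `Hom_A(B, M)` to `M`. -/
noncomputable def evalOne (M : ModuleCat.{u} Aᵐᵒᵖ) :
    (ModuleCat.restrictScalars.{u} (RingHom.op p)).obj
      ((bimoduleHom A B (Target p)).obj M) ⟶ M :=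
  ModuleCat.ofHom (X := (ModuleCat.restrictScalars.{u} (RingHom.op p)).obj
      ((bimoduleHom A B (Target p)).obj M)) (Y := M)
    { toFun := fun f => (show Target p →ₗ[Aᵐᵒᵖ] M from f) (Target.one p)
      map_add' := fun _ _ => rfl
      map_smul' := fun a f => by
        refine Eq.trans ?_ (map_smul (show Target p →ₗ[Aᵐᵒᵖ] M from f) a (Target.one p))
        exact congrArg (show Target p →ₗ[Aᵐᵒᵖ] M from f)
          ((mul_one (p a.unop)).trans (one_mul (p a.unop)).symm) }

/-- The morphism `N ⟶ Hom_A(B, N)` sending `n` to `b ↦ n b`. -/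
noncomputable def smulTarget (N : ModuleCat.{u} Bᵐᵒᵖ) :
    N ⟶ (bimoduleHom A B (Target p)).obj
      ((ModuleCat.restrictScalars.{u} (RingHom.op p)).obj N) :=
  ModuleCat.ofHom (X := N) (Y := BimoduleHom A B (Target p)
      ((ModuleCat.restrictScalars.{u} (RingHom.op p)).obj N))
    { toFun := fun n => show Target p →ₗ[Aᵐᵒᵖ]
          ((ModuleCat.restrictScalars.{u} (RingHom.op p)).obj N) from
        { toFun := fun b => (MulOpposite.op (show B from b) • n : N)
          map_add' := fun b c => add_smul (MulOpposite.op (show B from b)) (MulOpposite.op c) n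
          map_smul' := fun a b =>
            mul_smul (MulOpposite.op (p a.unop)) (MulOpposite.op (show B from b)) n }
      map_add' := fun n n' => LinearMap.ext fun b =>
        smul_add (MulOpposite.op (show B from b)) n n'
      map_smul' := fun b n => LinearMap.ext fun c =>
        (mul_smul (MulOpposite.op (show B from c)) b n).symm }

/-- Restriction of scalars along `p` is left adjoint to `Hom_A(B, -)`. -/
noncomputable def restrictScalarsAdjunction :
    ModuleCat.restrictScalars.{u} (RingHom.op p) ⊣ bimoduleHom A B (Target p) where
  unit :=
    { app := smulTarget p
      naturality := fun _ _ f => by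
        ext n
        exact LinearMap.ext fun b => (map_smul f.hom (MulOpposite.op (show B from b)) n).symm }
  counit :=
    { app := evalOne p
      naturality := fun _ _ _ => rfl }
  left_triangle_components N := by
    ext n
    exact one_smul Bᵐᵒᵖ (show N from n)
  right_triangle_components M := by
    ext f
    exact LinearMap.ext fun b =>
      congrArg (show Target p →ₗ[Aᵐᵒᵖ] M from f) (mul_one (show B from b))

/-- The morphism `M ⟶ Hom_A(I, M)` sending `m` to `k ↦ m k`, where `I` is an ideal. -/
def smulIdeal (I : TwoSidedIdeal A) : 𝟭 (ModuleCat.{u} Aᵐᵒᵖ) ⟶ bimoduleHom A A I where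
  app M := ModuleCat.ofHom (X := M) (Y := BimoduleHom A A I M)
    { toFun := fun m => show I →ₗ[Aᵐᵒᵖ] M from
        { toFun := fun k => MulOpposite.op (k : A) • m
          map_add' := fun k l => add_smul (MulOpposite.op (k : A)) (MulOpposite.op (l : A)) m
          map_smul' := fun a k => mul_smul a (MulOpposite.op (k : A)) m }
      map_add' := fun m m' => LinearMap.ext fun k => smul_add (MulOpposite.op (k : A)) m m'
      map_smul' := fun a m => LinearMap.ext fun k =>
        (mul_smul (MulOpposite.op (k : A)) a m).symm }
  naturality _ _ f := by
    ext m
    exact LinearMap.ext fun k => (map_smul f.hom (MulOpposite.op (k : A)) m).symm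

/-- For `k` in the kernel, `f(1) k = f(p k) = 0`. -/
lemma evalOne_smulIdeal (M : ModuleCat.{u} Aᵐᵒᵖ) :
    evalOne p M ≫ (smulIdeal (TwoSidedIdeal.ker p)).app M = 0 := by
  ext f
  refine LinearMap.ext fun k => ?_
  have hk : p k = 0 := (TwoSidedIdeal.mem_ker p).1 k.2
  let g := show Target p →ₗ[Aᵐᵒᵖ] M from f
  change MulOpposite.op (k : A) • g (Target.one p) = 0
  rw [← map_smul]
  have h0 : MulOpposite.op (k : A) • Target.one p = 0 := (op_smul_target_one p k).trans hk
  exact (congrArg g h0).trans (map_zero g)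

variable {p}

/-- Surjectivity identifies `B` with `A / ker p`, so a map is a choice of element killed by the
kernel. -/
lemma exists_linearMap_apply_one_eq (hp : Function.Surjective p) {M : Type u} [AddCommGroup M]
    [Module Aᵐᵒᵖ M] (m : M) (hm : ∀ k : A, p k = 0 → MulOpposite.op k • m = 0) :
    ∃ f : Target p →ₗ[Aᵐᵒᵖ] M, f (Target.one p) = m := by
  let π : Aᵐᵒᵖ →ₗ[Aᵐᵒᵖ] Target p := LinearMap.toSpanSingleton Aᵐᵒᵖ (Target p) (Target.one p)
  have hπ (a : A) : π (MulOpposite.op a) = (show Target p from p a) :=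
    op_smul_target_one p a
  have hsurj : Function.Surjective π := fun b =>
    let ⟨a, ha⟩ := hp b
    ⟨MulOpposite.op a, (hπ a).trans ha⟩
  have hker : LinearMap.ker π ≤ LinearMap.ker (LinearMap.toSpanSingleton Aᵐᵒᵖ M m) := fun a ha =>
    hm a.unop ((hπ a.unop).symm.trans ha)
  refine ⟨(LinearMap.ker π).liftQ _ hker ∘ₗ (π.quotKerEquivOfSurjective hsurj).symm, ?_⟩
  have h1 : (π.quotKerEquivOfSurjective hsurj).symm (Target.one p) = (LinearMap.ker π).mkQ 1 := by
    rw [LinearEquiv.symm_apply_eq]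
    exact ((hπ 1).trans (map_one p)).symm
  refine (congrArg _ h1).trans ?_
  exact one_smul _ m

/-- Surjectivity of `p` gives injectivity on the left and exactness in the middle. Injectivity of
`M` serves only on the right, to extend a map from `ker p` to `A`; the image of `1` is then the
preimage. -/
lemma shortExact_evalOne_smulIdeal (hp : Function.Surjective p) (M : ModuleCat.{u} Aᵐᵒᵖ)
    [Injective M] : (ShortComplex.mk _ _ (evalOne_smulIdeal p M)).ShortExact where
  exact := by
    rw [ShortComplex.moduleCat_exact_iff]
    intro m hm
    exact exists_linearMap_apply_one_eq hp m fun k hk =>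
      LinearMap.congr_fun (show (_ : TwoSidedIdeal.ker p →ₗ[Aᵐᵒᵖ] M) = 0 from hm)
        ⟨k, (TwoSidedIdeal.mem_ker p).2 hk⟩
  mono_f := by
    rw [ModuleCat.mono_iff_injective]
    refine (injective_iff_map_eq_zero _).2 fun f hf => LinearMap.ext fun b => ?_
    obtain ⟨a, ha⟩ := hp b
    let g := show Target p →ₗ[Aᵐᵒᵖ] M from f
    have hb : MulOpposite.op a • Target.one p = b := (op_smul_target_one p a).trans ha
    refine (congrArg g hb.symm).trans ((map_smul g _ _).trans ?_)
    exact (congrArg (MulOpposite.op a • ·) hf).trans (smul_zero _)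
  epi_g := by
    rw [ModuleCat.epi_iff_surjective]
    intro f
    let g := show TwoSidedIdeal.ker p →ₗ[Aᵐᵒᵖ] M from f
    let i : TwoSidedIdeal.ker p →ₗ[Aᵐᵒᵖ] Aᵐᵒᵖ :=
      { toFun := fun k => MulOpposite.op (k : A)
        map_add' := fun _ _ => rfl
        map_smul' := fun _ _ => rfl }
    have : Mono (ModuleCat.ofHom i) := by
      rw [ModuleCat.mono_iff_injective]
      exact fun k l h => Subtype.ext (MulOpposite.op_injective h)
    let h := Injective.factorThru (ModuleCat.ofHom g) (ModuleCat.ofHom i)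
    refine ⟨h.hom 1, LinearMap.ext fun k => ?_⟩
    have hk := ConcreteCategory.congr_hom
      (Injective.comp_factorThru (ModuleCat.ofHom g) (ModuleCat.ofHom i)) k
    refine ((map_smul h.hom (MulOpposite.op (k : A)) 1).symm.trans ?_).trans hk
    exact congrArg h.hom (mul_one (MulOpposite.op (k : A)))

end TwistRing

theorem theoremA {A B : Type u} [Ring A] [Ring B]
    [HasDerivedCategory.{w₁} (ModuleCat.{u} Aᵐᵒᵖ)]
    [HasDerivedCategory.{w₂} (ModuleCat.{u} Bᵐᵒᵖ)]
    (p : A →+* B) (hp : Function.Surjective p) :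
    (∃ _ : TwistRing.HasRHom.{w₁} A A (TwoSidedIdeal.ker p),
      TwistRing.IsTwistAround (TwistRing.restriction p)
        (TwistRing.RHom.{w₁, w₁} A A (TwoSidedIdeal.ker p))) ∧
    (∃ _ : TwistRing.HasRHom.{w₂} A B (TwistRing.Target p),
      Nonempty (TwistRing.restriction p ⊣ TwistRing.RHom A B (TwistRing.Target p))) := by
  let adj := TwistRing.restrictScalarsAdjunction p
  let β := TwistRing.rHomUnit.{w₁, w₂} A B (TwistRing.Target p)
  let adj' : TwistRing.restriction p ⊣ TwistRing.RHom A B (TwistRing.Target p) :=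
    adj.mapDerivedCategory β
  refine ⟨⟨inferInstance, ?_, adj'.isLeftAdjoint, fun R adjR => ?_⟩, inferInstance, ⟨adj'⟩⟩
  · have : (ModuleCat.restrictScalars.{u} (RingHom.op p)).leftAdjoint.Additive :=
      (Adjunction.ofIsRightAdjoint _).left_adjoint_additive
    exact (Adjunction.ofIsRightAdjoint
      (ModuleCat.restrictScalars.{u} (RingHom.op p))).isRightAdjoint_mapDerivedCategory
  · exact exists_twist_triangle adj (TwistRing.smulIdeal (TwoSidedIdeal.ker p))
      (TwistRing.evalOne_smulIdeal p) β
      (TwistRing.rHomUnit.{w₁, w₁} A A (TwoSidedIdeal.ker p))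
      (fun M _ => TwistRing.shortExact_evalOne_smulIdeal hp M) adjR
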